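/- Let $\mathcal H$ be a complex separable Hilbert space and let $H\subset\mathcal H$ be a standard subspace, i.e. a closed real-linear subspace such that $H+iH$ is dense and $H\cap iH=\{0\}$. Let $S_H:H+iH\to H+iH$, $h_1+ih_2\mapsto h_1-ih_2$, be its Tomita operator, with polar decomposition $S_H=J_H\Delta_H^{1/2}$ ($J_H$ antiunitary, $\Delta_H^{1/2}$ positive self-adjoint). For a real subspace $K\subset\mathcal H$ write $K'=\{v\in\mathcal H:\operatorname{Im}\langle v,k\rangle=0\ \forall k\in K\}$ and $K^{\perp_{\mathbb R}}=\{v\in\mathcal H:\operatorname{Re}\langle v,k\rangle=0\ \forall k\in K\}$. An endomorphism of $H$ is a unitary $U$ on $\mathcal H$ with $UH\subset H$; it is called proper if $UH\neq H$, and symmetric if $U=J_HU^*J_H$. For an endomorphism $U$ put $B_U:=U^*\Delta_H^{1/2}$ with domain $\operatorname{Dom}\Delta_H^{1/2}$, and $n_U^{\pm}:=\dim_{\mathbb C}\ker(B_U^*\mp i)$. Let $U$ be a proper endomorphism of $H$. (a) If $U$ is symmetric, then $$\dim_{\mathbb R}\big((UH)^{\perp_{\mathbb R}}\cap H\big)\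 \geq\ n_U^++n_U^->0 .$$ (b) If $U=V^2$ for some symmetric endomorphism $V$ of $H$, then $n_U^+=n_U^-$ and $$\dim_{\mathbb R}\big((UH)'\cap H\big)\ \geq\ n_U^+>0 .$$ In particular, the inclusion $UH\subset H$ is not singular in this case, i.e. $(UH)'\cap H\neq\{0\}$. Dimensions are algebraic dimensions (cardinal numbers); in particular all statements also hold for dimensions with values in $\{0,1,2,\dots,\infty\}$. -/

import Mathlib

open scoped ComplexInnerProductSpace
open ClosedSubmodule Complex

namespace StandardSubspace

variable {E : Type*} [NormedAddCommGroup E] [InnerProductSpace ℂ E]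

theorem mem_mulI_iff (H : StandardSubspace E) (x : E) :
    x ∈ H.toClosedSubmodule.mulI ↔ I • x ∈ H.toClosedSubmodule := by
  rw [ClosedSubmodule.mem_mapEquiv_iff, scalarSMulCLE_symm_apply]
  have : (UnitI⁻¹ : ℂˣ) • x = -(I • x) := by
    rw [Units.smul_def, Units.val_inv_eq_inv_val, val_UnitI, inv_I, neg_smul]
  rw [this]
  exact neg_mem_iff (S := Submodule ℝ E) (H := H.toClosedSubmodule.toSubmodule)

theorem eq_zero_of_mem (H : StandardSubspace E) {x : E} (hx : x ∈ H.toClosedSubmodule)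
    (hx' : I • x ∈ H.toClosedSubmodule) : x = 0 := by
  have : x ∈ H.toClosedSubmodule ⊓ H.toClosedSubmodule.mulI :=
    ⟨hx, (H.mem_mulI_iff x).2 hx'⟩
  rw [H.IsSeparating] at this
  simpa using this

theorem decomp_unique (H : StandardSubspace E) {h k h' k' : E}
    (hh : h ∈ H.toClosedSubmodule) (hk : k ∈ H.toClosedSubmodule)
    (hh' : h' ∈ H.toClosedSubmodule) (hk' : k' ∈ H.toClosedSubmodule)
    (e : h + I • k = h' + I • k') : h = h' ∧ k = k' := by
  have h1 : I • (k - k') = h' - h := by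
    rw [smul_sub, sub_eq_sub_iff_add_eq_add, add_comm, e, add_comm]
  have h2 : k - k' = 0 := H.eq_zero_of_mem
    (sub_mem (S := Submodule ℝ E) (H := H.toClosedSubmodule.toSubmodule) hk hk')
    (h1 ▸ sub_mem (S := Submodule ℝ E) (H := H.toClosedSubmodule.toSubmodule) hh' hh)
  rw [h2, smul_zero] at h1
  exact ⟨(sub_eq_zero.1 h1.symm).symm, sub_eq_zero.1 h2⟩

/-- The complex linear span `H + iH` of a standard subspace `H`. -/
def complexSpan (H : StandardSubspace E) : Submodule ℂ E where
  carrier := {x | ∃ h ∈ H.toClosedSubmodule, ∃ k ∈ H.toClosedSubmodule, x = h + I • k}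
  zero_mem' := ⟨0, zero_mem H.toClosedSubmodule.toSubmodule, 0,
    zero_mem H.toClosedSubmodule.toSubmodule, by simp⟩
  add_mem' := by
    rintro _ _ ⟨h, hh, k, hk, rfl⟩ ⟨h', hh', k', hk', rfl⟩
    exact ⟨h + h', add_mem (S := Submodule ℝ E) (s := H.toClosedSubmodule.toSubmodule) hh hh',
      k + k', add_mem (S := Submodule ℝ E) (s := H.toClosedSubmodule.toSubmodule) hk hk',
      by rw [smul_add]; abel⟩
  smul_mem' := by
    rintro c _ ⟨h, hh, k, hk, rfl⟩
    have s (r : ℝ) {x : E} (hx : x ∈ H.toClosedSubmodule) : r • x ∈ H.toClosedSubmodule :=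
      H.toClosedSubmodule.toSubmodule.smul_mem r hx
    refine ⟨c.re • h - c.im • k,
      sub_mem (S := Submodule ℝ E) (H := H.toClosedSubmodule.toSubmodule) (s _ hh) (s _ hk),
      c.re • k + c.im • h,
      add_mem (S := Submodule ℝ E) (s := H.toClosedSubmodule.toSubmodule) (s _ hk) (s _ hh), ?_⟩
    simp only [← Complex.coe_smul]
    nth_rewrite 1 [← Complex.re_add_im c]
    match_scalars
    · ring
    · linear_combination (c.im : ℂ) * Complex.I_sq

theorem exists_tomita (H : StandardSubspace E) (x : H.complexSpan) :
    ∃ y : E, ∃ h ∈ H.toClosedSubmodule, ∃ k ∈ H.toClosedSubmodule,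
      (x : E) = h + I • k ∧ y = h - I • k := by
  obtain ⟨h, hh, k, hk, e⟩ := x.2
  exact ⟨_, h, hh, k, hk, e, rfl⟩

theorem tomita_aux (H : StandardSubspace E) (x : H.complexSpan) {h k : E}
    (hh : h ∈ H.toClosedSubmodule) (hk : k ∈ H.toClosedSubmodule) (e : (x : E) = h + I • k) :
    (H.exists_tomita x).choose = h - I • k := by
  obtain ⟨h', hh', k', hk', e', e''⟩ := (H.exists_tomita x).choose_spec
  obtain ⟨rfl, rfl⟩ := H.decomp_unique hh hk hh' hk' (e ▸ e')
  exact e''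

/-- The Tomita operator `S_H : H + iH → H + iH`, `h + ik ↦ h - ik`, as a partially defined
antilinear operator. -/
noncomputable def tomita (H : StandardSubspace E) : E →ₛₗ.[starRingEnd ℂ] E where
  domain := H.complexSpan
  toFun :=
    { toFun := fun x => (H.exists_tomita x).choose
      map_add' := by
        intro x y
        obtain ⟨h, hh, k, hk, e⟩ := x.2
        obtain ⟨h', hh', k', hk', e'⟩ := y.2
        rw [H.tomita_aux x hh hk e, H.tomita_aux y hh' hk' e',
          H.tomita_aux (x + y) (h := h + h') (k := k + k')
            (add_mem (S := Submodule ℝ E) (s := H.toClosedSubmodule.toSubmodule) hh hh')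
            (add_mem (S := Submodule ℝ E) (s := H.toClosedSubmodule.toSubmodule) hk hk')
            (by rw [Submodule.coe_add, e, e', smul_add]; abel)]
        rw [smul_add]; abel
      map_smul' := by
        intro c x
        obtain ⟨h, hh, k, hk, e⟩ := x.2
        have s (r : ℝ) {x : E} (hx : x ∈ H.toClosedSubmodule) : r • x ∈ H.toClosedSubmodule :=
          H.toClosedSubmodule.toSubmodule.smul_mem r hx
        rw [H.tomita_aux x hh hk e, H.tomita_aux (c • x)
          (h := c.re • h - c.im • k) (k := c.re • k + c.im • h)
          (sub_mem (S := Submodule ℝ E) (H := H.toClosedSubmodule.toSubmodule) (s _ hh) (s _ hk))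
          (add_mem (S := Submodule ℝ E) (s := H.toClosedSubmodule.toSubmodule) (s _ hk) (s _ hh))
          ?_]
        · simp only [← Complex.coe_smul]
          have hc : (starRingEnd ℂ) c = c.re - c.im * I := by
            apply Complex.ext <;> simp
          rw [hc]
          match_scalars
          · ring
          · linear_combination (-(c.im : ℂ)) * Complex.I_sq
        · rw [Submodule.coe_smul, e]
          simp only [← Complex.coe_smul]
          nth_rewrite 1 [← Complex.re_add_im c]
          match_scalars
          · ring
          · linear_combination (c.im : ℂ) * Complex.I_sq }

theorem tomita_apply (H : StandardSubspace E) (x : H.tomita.domain) {h k : E}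
    (hh : h ∈ H.toClosedSubmodule) (hk : k ∈ H.toClosedSubmodule) (e : (x : E) = h + I • k) :
    H.tomita x = h - I • k :=
  H.tomita_aux x hh hk e

theorem aux_im (x y : E) : (⟪x, y⟫).im = -(⟪x, I • y⟫).re := by
  simp

theorem aux_sa {T : E →L[ℂ] E} (h : 0 ≤ T) (x y : E) : ⟪T x, y⟫ = ⟪x, T y⟫ :=
  ((ContinuousLinearMap.nonneg_iff_isPositive T).1 h).isSymmetric x y

theorem aux_re {T : E →L[ℂ] E} (h : 0 ≤ T) (x : E) : 0 ≤ (⟪T x, x⟫).re :=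
  ((ContinuousLinearMap.nonneg_iff_isPositive T).1 h).re_inner_nonneg_left x

theorem aux_inner (J : E ≃ₗᵢ⋆[ℂ] E) (x y : E) : (⟪J x, J y⟫).re = (⟪x, y⟫).re := by
  have h1 := re_inner_eq_norm_add_mul_self_sub_norm_mul_self_sub_norm_mul_self_div_two (𝕜 := ℂ) x y
  have h2 := re_inner_eq_norm_add_mul_self_sub_norm_mul_self_sub_norm_mul_self_div_two (𝕜 := ℂ)
    (J x) (J y)
  rw [← map_add, J.norm_map, J.norm_map, J.norm_map] at h2
  exact h2.trans h1.symm

theorem aux_inner' (J : E ≃ₗᵢ⋆[ℂ] E) (x y : E) : (⟪J x, y⟫).re = (⟪x, J.symm y⟫).re := by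
  rw [← aux_inner J x, J.apply_symm_apply]

theorem aux_pos (T : E →L[ℂ] E) (hs : ∀ x y, (⟪T x, y⟫).re = (⟪x, T y⟫).re)
    (hp : ∀ x, 0 ≤ (⟪T x, x⟫).re) : 0 ≤ T := by
  rw [ContinuousLinearMap.nonneg_iff_isPositive, ContinuousLinearMap.isPositive_def]
  refine ⟨fun x y => Complex.ext (hs x y) ?_, hp⟩
  change (⟪T x, y⟫).im = (⟪x, T y⟫).im
  rw [aux_im, aux_im, hs, map_smul]

variable [CompleteSpace E]

theorem aux_dense (K : Submodule ℂ E) (h : ∀ y, (∀ x ∈ K, (⟪x, y⟫).re = 0) → y = 0) :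
    Dense (K : Set E) := by
  rw [Submodule.dense_iff_topologicalClosure_eq_top, Submodule.topologicalClosure_eq_top_iff,
    Submodule.eq_bot_iff]
  intro y hy
  exact h y fun x hx => by rw [(Submodule.mem_orthogonal K y).1 hy x hx, zero_re]

theorem aux_conj (J : E ≃ₗᵢ⋆[ℂ] E) {T S : E →L[ℂ] E} (hT : 0 ≤ T) (hS : 0 ≤ S)
    (h : ∀ x, J (T (T x)) = S (S (J x))) (x : E) : J (T x) = S (J x) := by
  let M : E →L[ℂ] E :=
    { toFun := fun x => J (T (J.symm x))
      map_add' := fun x y => by simp only [map_add]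
      map_smul' := fun c x => by simp [map_smulₛₗ]
      cont := by fun_prop }
  have hMx (x : E) : M x = J (T (J.symm x)) := rfl
  have hM : 0 ≤ M := aux_pos M
    (fun x y => by
      rw [hMx, hMx, aux_inner', aux_sa hT, ← aux_inner J, J.apply_symm_apply])
    fun x => by rw [hMx, aux_inner']; exact aux_re hT _
  have hMM : M * M = S * S := by
    ext y
    change M (M y) = S (S y)
    rw [hMx, hMx, J.symm_apply_apply, h, J.apply_symm_apply]
  have : M = S := by rw [← CFC.sqrt_mul_self M hM, hMM, CFC.sqrt_mul_self S hS]
  rw [← this, hMx, J.symm_apply_apply]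

theorem aux_polar (P : E →L[ℝ] E) (hsym : ∀ x y, (⟪P x, y⟫).re = (⟪x, P y⟫).re)
    (hid : ∀ x, P (P x) = P x)
    (hcyc : ∀ x, P x = 0 → P (I • x) = 0 → x = 0)
    (hsep : ∀ x, P x = x → P (I • x) = I • x → x = 0) :
    ∃ (J : E ≃ₗᵢ⋆[ℂ] E) (a b : E →L[ℂ] E), (∀ x y, ⟪a x, y⟫ = ⟪x, a y⟫) ∧
      (∀ x y, ⟪b x, y⟫ = ⟪x, b y⟫) ∧ (∀ x, a (b x) = b (a x)) ∧
      (∀ x, a x = 0 → x = 0) ∧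
      (∀ x, 0 ≤ (⟪a x, b x⟫).re) ∧ (∀ x, a (a x) + b (b x) = x + x) ∧
      (∀ x, J (J x) = x) ∧ (∀ x, J (a x) = b (J x)) ∧ (∀ x, J (b x) = a (J x)) ∧
      (∀ x, a (a x) + J (a (b x)) = P x + P x) := by
  have hI (x : E) : I • I • x = -x := by rw [smul_smul, I_mul_I, neg_one_smul]
  let R : E →L[ℂ] E :=
    { toFun := fun x => P x - I • P (I • x)
      map_add' := fun x y => by simp only [smul_add, map_add]; abel
      map_smul' := fun c x => by
        have key : ∀ x, P (I • x) - I • P (I • I • x) = I • (P x - I • P (I • x)) := fun x => by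
          rw [hI, map_neg, smul_neg, smul_sub, hI]; abel
        have hr (r : ℝ) (x : E) : P ((r : ℂ) • x) - I • P (I • (r : ℂ) • x)
            = (r : ℂ) • (P x - I • P (I • x)) := by
          rw [smul_comm I (r : ℂ) x]
          simp only [Complex.coe_smul, map_smul]
          rw [smul_sub, smul_comm I r]
        rw [RingHom.id_apply, ← Complex.re_add_im c, add_smul, add_smul, smul_add, map_add, map_add,
          smul_add, add_sub_add_comm, hr, mul_smul, hr, key, mul_smul]
      cont := by fun_prop }
  let D : E →ₛₗ[starRingEnd ℂ] E :=
    { toFun := fun x => P x + I • P (I • x)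
      map_add' := fun x y => by simp only [smul_add, map_add]; abel
      map_smul' := fun c x => by
        have key : ∀ x, P (I • x) + I • P (I • I • x) = -(I • (P x + I • P (I • x))) := fun x => by
          rw [hI, map_neg, smul_neg, smul_add, hI]; abel
        have hr (r : ℝ) (x : E) : P ((r : ℂ) • x) + I • P (I • (r : ℂ) • x)
            = (r : ℂ) • (P x + I • P (I • x)) := by
          rw [smul_comm I (r : ℂ) x]
          simp only [Complex.coe_smul, map_smul]
          rw [smul_add, smul_comm I r]
        have hc : (starRingEnd ℂ) c = c.re - c.im * I := by
            apply Complex.ext <;> simp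
        rw [hc]
        nth_rewrite 1 2 [← Complex.re_add_im c]
        rw [add_smul, sub_smul, smul_add, map_add, map_add,
          smul_add, add_add_add_comm, hr, mul_smul, hr, key, mul_smul, smul_neg, sub_eq_add_neg] }
  have hRx (x : E) : R x = P x - I • P (I • x) := rfl
  have hDx (x : E) : D x = P x + I • P (I • x) := rfl
  have hDcont : Continuous D := by
    change Continuous fun x => P x + I • P (I • x)
    fun_prop
  have hIin (x y : E) : (⟪I • x, y⟫).re = -(⟪x, I • y⟫).re := by
    simp
  have hRsym (x y : E) : (⟪R x, y⟫).re = (⟪x, R y⟫).re := by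
    rw [hRx, hRx, inner_sub_left, inner_sub_right, sub_re, sub_re, hIin, hsym, hsym, hIin]
    rw [← neg_eq_iff_eq_neg.2 (hIin x (P (I • y)))]; ring
  have hDsym (x y : E) : (⟪D x, y⟫).re = (⟪x, D y⟫).re := by
    rw [hDx, hDx, inner_add_left, inner_add_right, add_re, add_re, hIin, hsym, hsym, hIin]
    rw [← neg_eq_iff_eq_neg.2 (hIin x (P (I • y)))]; ring
  have hPn (x : E) : (⟪P x, x⟫).re = ‖P x‖ ^ 2 := by
    rw [← hid, hsym, hid, inner_self_eq_norm_sq_to_K]; norm_cast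
  have hRq (x : E) : (⟪R x, x⟫).re = ‖P x‖ ^ 2 + ‖P (I • x)‖ ^ 2 := by
    rw [hRx, inner_sub_left, sub_re, hIin, hPn, hPn]; ring
  have hPn2 (x : E) : ‖x - P x‖ ^ 2 = ‖x‖ ^ 2 - ‖P x‖ ^ 2 := by
    rw [@norm_sub_sq ℂ]
    change ‖x‖ ^ 2 - 2 * (⟪x, P x⟫).re + _ = _
    rw [← hsym, hPn]; ring
  have hRpos : 0 ≤ R := aux_pos R hRsym fun x => by rw [hRq]; positivity
  let Q : E →L[ℂ] E := 1 + 1 - R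
  have hQx (x : E) : Q x = x + x - R x := rfl
  have hQq (x : E) : (⟪Q x, x⟫).re = ‖x - P x‖ ^ 2 + ‖I • x - P (I • x)‖ ^ 2 := by
    rw [hQx, inner_sub_left, sub_re, hRq, hPn2, hPn2, norm_smul, norm_I, inner_add_left, add_re]
    have : (⟪x, x⟫).re = ‖x‖ ^ 2 := inner_self_eq_norm_sq (𝕜 := ℂ) x
    rw [this]
    ring
  have hQsym (x y : E) : (⟪Q x, y⟫).re = (⟪x, Q y⟫).re := by
    rw [hQx, hQx, inner_sub_left, inner_sub_right, sub_re, sub_re, hRsym, inner_add_left,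
      inner_add_right]
  have hQpos : 0 ≤ Q := aux_pos Q hQsym fun x => by rw [hQq]; positivity
  have hRinj (x : E) (hx : R x = 0) : x = 0 := by
    have h := hRq x
    rw [hx, inner_zero_left, zero_re] at h
    exact hcyc x (norm_eq_zero.1 (by nlinarith [norm_nonneg (P x), norm_nonneg (P (I • x))]))
      (norm_eq_zero.1 (by nlinarith [norm_nonneg (P x), norm_nonneg (P (I • x))]))
  have hQinj (x : E) (hx : Q x = 0) : x = 0 := by
    have h := hQq x
    rw [hx, inner_zero_left, zero_re] at h
    have h1 := norm_nonneg (x - P x)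
    have h2 := norm_nonneg (I • x - P (I • x))
    exact hsep x (sub_eq_zero.1 (norm_eq_zero.1 (by nlinarith))).symm
      (sub_eq_zero.1 (norm_eq_zero.1 (by nlinarith))).symm
  have hRQ : Commute R Q := by
    ext x; simp [hQx]
  have hDD (x : E) : D (D x) = R (Q x) := by
    simp only [hDx, hRx, hQx, map_add, map_sub, smul_add, smul_sub, hI, hid, map_neg, smul_neg]
    abel
  have hDR (x : E) : D (R x) = Q (D x) := by
    simp only [hDx, hRx, hQx, map_add, map_sub, smul_add, smul_sub, hI, hid, map_neg, smul_neg]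
    abel
  have hDinj (x : E) (hx : D x = 0) : x = 0 :=
    hQinj x (hRinj _ (by rw [← hDD, hx, map_zero]))
  set a : E →L[ℂ] E := CFC.sqrt R with ha
  set b : E →L[ℂ] E := CFC.sqrt Q with hb
  have ha0 : 0 ≤ a := CFC.sqrt_nonneg R
  have hb0 : 0 ≤ b := CFC.sqrt_nonneg Q
  have haa : a * a = R := CFC.sqrt_mul_sqrt_self R hRpos
  have hbb : b * b = Q := CFC.sqrt_mul_sqrt_self Q hQpos
  have hRa : Commute a R := (Commute.refl R).cfcₙ_nnreal _
  have hRb : Commute b R := hRQ.symm.cfcₙ_nnreal _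
  have hab : Commute a b := (hRb.symm.cfcₙ_nnreal _ : Commute (CFC.sqrt R) b)
  have haax (x : E) : a (a x) = R x := by rw [← haa]; rfl
  have hbbx (x : E) : b (b x) = Q x := by rw [← hbb]; rfl
  have habx (x : E) : a (b x) = b (a x) := congrArg (fun T : E →L[ℂ] E => T x) hab.eq
  let c : E →L[ℂ] E := a * b
  have hcx (x : E) : c x = a (b x) := rfl
  have hc0 : 0 ≤ c := Commute.mul_nonneg ha0 hb0 hab
  have hcc (x : E) : c (c x) = R (Q x) := by
    rw [hcx, hcx, ← haax, ← hbbx, ← habx (b x)]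
  have hcinj (x : E) (hx : c x = 0) : x = 0 :=
    hQinj x (hRinj _ (by rw [← hcc, hx, map_zero]))
  have hcD (x : E) : ‖D x‖ = ‖c x‖ := by
    rw [← sq_eq_sq₀ (norm_nonneg _) (norm_nonneg _)]
    rw [← inner_self_eq_norm_sq (𝕜 := ℂ), ← inner_self_eq_norm_sq (𝕜 := ℂ)]
    change (⟪D x, D x⟫).re = (⟪c x, c x⟫).re
    rw [hDsym, aux_sa hc0, hDD, hcc]
  have hcdense : DenseRange c := by
    refine aux_dense (LinearMap.range c.toLinearMap) fun y hy => hcinj y ?_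
    rw [← norm_eq_zero, ← sq_eq_zero_iff, ← inner_self_eq_norm_sq (𝕜 := ℂ), ← aux_sa hc0]
    exact hy _ ⟨_, rfl⟩
  have hDdense : DenseRange D := by
    refine aux_dense (LinearMap.range D) fun y hy => hDinj y ?_
    rw [← norm_eq_zero, ← sq_eq_zero_iff, ← inner_self_eq_norm_sq (𝕜 := ℂ)]
    change (⟪D y, D y⟫).re = 0
    rw [← hDsym]
    exact hy _ ⟨_, rfl⟩
  obtain ⟨J, hJ⟩ : ∃ J : E ≃ₗᵢ⋆[ℂ] E, ∀ x, J (c x) = D x := by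
    let f := LinearEquiv.ofInjective D ((injective_iff_map_eq_zero D).2 hDinj)
    have h2 : DenseRange (LinearMap.range D).subtype := by
      have : Set.range (LinearMap.range D).subtype = Set.range D := by ext x; simp
      rw [DenseRange, this]
      exact hDdense
    refine ⟨f.extendOfIsometry c.toLinearMap (LinearMap.range D).subtype hcdense h2
      (fun x => hcD x), fun x => ?_⟩
    exact f.extendOfIsometry_eq c.toLinearMap (LinearMap.range D).subtype hcdense h2
      (fun x => hcD x) x
  have hJs (x : E) : J (c x) = c (J.symm x) := by
    refine ext_inner_left ℂ fun y => Complex.ext ?_ ?_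
    · rw [← aux_sa hc0, ← aux_inner', hJ, hJ, hDsym]
    · have e (z : E) : (⟪y, z⟫).im = (⟪I • y, z⟫).re := by simp
      rw [e, e, ← aux_sa hc0, ← aux_inner', hJ, hJ, hDsym]
  have hJc (x : E) : J (c x) = c (J x) := aux_conj J hc0 hc0 (fun x => by
    rw [hcc (J x), ← hDD, ← hJ, ← hJ, hJs (J x), J.symm_apply_apply]) x
  have hJJ (x : E) : J (J x) = x := by
    have h1 : c (J x - J.symm x) = 0 := by rw [map_sub, ← hJc, ← hJs, sub_self]
    rw [sub_eq_zero.1 (hcinj _ h1), J.apply_symm_apply]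
  have hcR : Commute c R := hRa.mul_left hRb
  have hcQ : Commute c Q :=
    ((hRQ.symm.symm.cfcₙ_nnreal _ : Commute (CFC.sqrt R) Q)).mul_left
      ((Commute.refl Q).cfcₙ_nnreal _ : Commute (CFC.sqrt Q) Q)
  have hcRx (x : E) : c (R x) = R (c x) := congrArg (fun T : E →L[ℂ] E => T x) hcR.eq
  have hcQx (x : E) : c (Q x) = Q (c x) := congrArg (fun T : E →L[ℂ] E => T x) hcQ.eq
  have hJR (x : E) : J (R x) = Q (J x) := by
    refine sub_eq_zero.1 (hcinj _ ?_)
    rw [map_sub, ← hJc, hJ, hDR, hcQx, ← hJc, hJ, sub_self]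
  have hJa (x : E) : J (a x) = b (J x) :=
    aux_conj J ha0 hb0 (fun x => by rw [haax, hbbx, hJR]) x
  refine ⟨J, a, b, aux_sa ha0, aux_sa hb0, habx, fun x hx => hRinj x (by rw [← haax, hx, map_zero]),
    fun x => ?_, fun x => ?_, hJJ, hJa, fun x => ?_, fun x => ?_⟩
  · rw [aux_sa ha0]
    exact (aux_re hc0 x).trans_eq (by rw [aux_sa hc0, hcx])
  · rw [haax, hbbx, hQx]; abel
  · rw [← hJJ (a (J x)), hJa, hJJ]
  · rw [haax, ← hcx, hJ, hRx, hDx]; abel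

/-- `S = J R` is the polar decomposition of the injective antilinear operator `S` with dense range:
`R` is a positive self-adjoint operator and `J` is antiunitary. -/
structure IsPolarDecomposition (S : E →ₛₗ.[starRingEnd ℂ] E)
    (J : E ≃ₗᵢ⋆[ℂ] E) (R : E →ₗ.[ℂ] E) : Prop where
  isSelfAdjoint : IsSelfAdjoint R
  nonneg : ∀ x : R.domain, 0 ≤ (⟪R x, (x : E)⟫).re
  eq_comp : S = J.toLinearEquiv.toLinearMap.compPMap R

theorem exists_isPolarDecomposition (H : StandardSubspace E) :
    ∃ (J : E ≃ₗᵢ⋆[ℂ] E) (R : E →ₗ.[ℂ] E), IsPolarDecomposition H.tomita J R := by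
  let K : Submodule ℝ E := H.toClosedSubmodule.toSubmodule
  have hKc : IsClosed (K : Set E) := H.toClosedSubmodule.isClosed
  have : CompleteSpace K := hKc.completeSpace_coe
  let P : E →L[ℝ] E := K.starProjection
  have hsym (x y : E) : (⟪P x, y⟫).re = (⟪x, P y⟫).re :=
    K.inner_starProjection_left_eq_right x y
  have hPK (x : E) : P x ∈ K := K.starProjection_apply_mem x
  have hPe (x : E) : P x = x ↔ x ∈ K := K.starProjection_eq_self_iff
  have hcyc (x : E) (h1 : P x = 0) (h2 : P (I • x) = 0) : x = 0 := by
    have o (y : E) (hy : P y = 0) (k : E) (hk : k ∈ K) : (⟪k, y⟫).re = 0 := by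
      rw [← (hPe k).2 hk, hsym, hy, inner_zero_right, zero_re]
    have hx : x ∈ (H.toClosedSubmodule ⊔ H.toClosedSubmodule.mulI)ᗮ := by
      rw [← ClosedSubmodule.inf_orthogonal]
      refine ⟨fun k hk => o x h1 k hk, fun k hk => ?_⟩
      have := o (I • x) h2 (I • k) ((H.mem_mulI_iff k).1 hk)
      simpa [inner_real_eq_re_inner, inner_smul_left, inner_smul_right] using this
    rw [H.IsCyclic, ClosedSubmodule.top_orthogonal_eq_bot] at hx
    exact hx
  have hsep (x : E) (h1 : P x = x) (h2 : P (I • x) = I • x) : x = 0 :=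
    H.eq_zero_of_mem ((hPe x).1 h1) ((hPe _).1 h2)
  obtain ⟨J, a, b, has, hbs, hab, hainj, hpos, h2, hJJ, hJa, hJb, hP⟩ :=
    aux_polar P hsym (fun x => (hPe _).2 (hPK x)) hcyc hsep
  have hI' : Function.Injective a := (injective_iff_map_eq_zero a).2 hainj
  let e := LinearEquiv.ofInjective a.toLinearMap hI'
  let T : E →ₗ.[ℂ] E :=
    { domain := LinearMap.range a.toLinearMap
      toFun := b.toLinearMap ∘ₗ e.symm.toLinearMap }
  have hT (x : T.domain) (w : E) (hw : a w = x) : T x = b w := by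
    have : x = e w := Subtype.ext hw.symm
    change b (e.symm x) = b w
    rw [this, e.symm_apply_apply]
  have hdense : Dense (T.domain : Set E) := by
    refine aux_dense _ fun y hy => hainj y ?_
    rw [← norm_eq_zero, ← sq_eq_zero_iff, ← inner_self_eq_norm_sq (𝕜 := ℂ), ← has]
    exact hy _ ⟨_, rfl⟩
  have hle : T ≤ T.adjoint := by
    refine LinearPMap.IsFormalAdjoint.le_adjoint hdense ?_
    rintro ⟨_, x, rfl⟩ ⟨_, y, rfl⟩
    rw [hT _ x rfl, hT _ y rfl]
    change ⟪b x, a y⟫ = ⟪a x, b y⟫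
    rw [hbs, has, hab]
  have hsa : IsSelfAdjoint T := by
    rw [LinearPMap.isSelfAdjoint_def]
    refine (LinearPMap.eq_of_le_of_domain_eq hle (le_antisymm hle.1 fun y hy => ?_)).symm
    have hz : a (T.adjoint ⟨y, hy⟩) = b y := by
      refine ext_inner_right ℂ fun x => ?_
      have := LinearPMap.adjoint_isFormalAdjoint hdense ⟨y, hy⟩ ⟨a x, x, rfl⟩
      rw [hT _ x rfl] at this
      rw [has, hbs]
      exact this
    refine ⟨(2⁻¹ : ℂ) • (a y + b (T.adjoint ⟨y, hy⟩)), ?_⟩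
    change a _ = y
    rw [map_smul, map_add, hab, hz, h2, ← two_smul ℂ, smul_smul]
    norm_num
  have two {x y : E} (h : x + x = y + y) : x = y := by
    rw [← two_smul ℂ, ← two_smul ℂ y] at h
    exact smul_right_injective E (two_ne_zero (α := ℂ)) h
  have hc2 : (starRingEnd ℂ) 2⁻¹ = 2⁻¹ := by rw [map_inv₀, map_ofNat]
  have hK1 (w : E) (h : J (b w) = a w) : a w ∈ K := by
    rw [← hPe]
    refine two ?_
    rw [← hP, ← map_add, ← h2 w, map_add, ← hab w, hJa, hJa, h, hab (b w), hab w]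
  have hK2 (y : E) (hy : y ∈ K) : ∃ w, a w = y ∧ J (b w) = y := by
    have h := hP y
    rw [(hPe y).2 hy] at h
    refine ⟨(2⁻¹ : ℂ) • (a y + b (J y)), ?_, ?_⟩
    · have h' : J (a (b y)) = a (b (J y)) := by rw [hJa, hJb, ← hab]
      rw [map_smul, map_add, ← h', h, ← two_smul ℂ, smul_smul]
      norm_num
    · rw [map_smul, map_smulₛₗ, hc2, map_add, map_add, hJb (b _), hJb (J y), hJJ, ← hab,
        add_comm, h, ← two_smul ℂ, smul_smul]
      norm_num
  have hdec (w : E) : ∃ h ∈ K, ∃ k ∈ K, a w = h + I • k ∧ J (b w) = h - I • k := by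
    refine ⟨a ((2⁻¹ : ℂ) • (w + J w)), hK1 _ ?_, a ((-(I * 2⁻¹) : ℂ) • (w - J w)), hK1 _ ?_, ?_, ?_⟩
    · simp only [map_smul, map_smulₛₗ, hc2, map_add, hJb, hJJ, add_comm]
    · simp only [map_smul, map_smulₛₗ, map_neg, map_mul, conj_I, hc2, map_sub, hJb, hJJ]
      match_scalars <;> ring
    · simp only [map_smul, map_add, map_sub]
      match_scalars
      · linear_combination (2⁻¹ : ℂ) * Complex.I_sq
      · linear_combination (-2⁻¹ : ℂ) * Complex.I_sq
    · simp only [map_smul, map_add, map_sub, hJb]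
      match_scalars
      · linear_combination (2⁻¹ : ℂ) * Complex.I_sq
      · linear_combination (-2⁻¹ : ℂ) * Complex.I_sq
  refine ⟨J, T, hsa, ?_, LinearPMap.ext (le_antisymm ?_ ?_) ?_⟩
  · rintro ⟨_, w, rfl⟩
    rw [hT _ w rfl]
    have := hpos w
    rwa [← inner_conj_symm, conj_re] at this
  · rintro _ ⟨h, hh, k, hk, rfl⟩
    obtain ⟨w, hw, -⟩ := hK2 h hh
    obtain ⟨w', hw', -⟩ := hK2 k hk
    exact ⟨w + I • w', by simp [hw, hw']⟩
  · rintro _ ⟨w, rfl⟩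
    obtain ⟨h, hh, k, hk, e1, -⟩ := hdec w
    exact ⟨h, hh, k, hk, e1⟩
  · rintro _ hx ⟨w, rfl⟩
    obtain ⟨h, hh, k, hk, e1, e2⟩ := hdec w
    rw [H.tomita_apply ⟨_, hx⟩ hh hk e1, ← e2]
    exact (congrArg J (hT ⟨a w, w, rfl⟩ w rfl)).symm

/-- The modular conjugation `J_H`: the antiunitary part of the (unique) polar decomposition
`S_H = J_H Δ_H^{1/2}` of the Tomita operator. -/
noncomputable def modularConj (H : StandardSubspace E) : E ≃ₗᵢ⋆[ℂ] E :=
  H.exists_isPolarDecomposition.choose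

/-- The square root `Δ_H^{1/2}` of the modular operator: the positive self-adjoint part of the
(unique) polar decomposition `S_H = J_H Δ_H^{1/2}` of the Tomita operator. -/
noncomputable def modularSqrt (H : StandardSubspace E) : E →ₗ.[ℂ] E :=
  H.exists_isPolarDecomposition.choose_spec.choose

theorem isPolarDecomposition_tomita (H : StandardSubspace E) :
    IsPolarDecomposition H.tomita H.modularConj H.modularSqrt :=
  H.exists_isPolarDecomposition.choose_spec.choose_spec

/-- The image `UH` of a standard subspace under a unitary `U`, as a closed real subspace. -/
noncomputable def image (H : StandardSubspace E) (U : E ≃ₗᵢ[ℂ] E) : ClosedSubmodule ℝ E :=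
  H.toClosedSubmodule.mapEquiv (U.toContinuousLinearEquiv.restrictScalars ℝ)

/-- A unitary `U` is an endomorphism of `H` if `UH ⊆ H`. -/
def IsEndomorphism (H : StandardSubspace E) (U : E ≃ₗᵢ[ℂ] E) : Prop :=
  H.image U ≤ H.toClosedSubmodule

/-- An endomorphism `U` of `H` is proper if `UH ⊊ H`. -/
def IsProperEndomorphism (H : StandardSubspace E) (U : E ≃ₗᵢ[ℂ] E) : Prop :=
  H.image U < H.toClosedSubmodule

/-- `U^♯ = J_H U^* J_H`. -/
noncomputable def sharp (H : StandardSubspace E) (U : E ≃ₗᵢ[ℂ] E) : E ≃ₗᵢ[ℂ] E :=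
  (H.modularConj.trans U.symm).trans H.modularConj

/-- The operator `B_U = U^* Δ_H^{1/2}`, with the domain of `Δ_H^{1/2}`. -/
noncomputable def opB (H : StandardSubspace E) (U : E ≃ₗᵢ[ℂ] E) : E →ₗ.[ℂ] E :=
  U.symm.toLinearEquiv.toLinearMap.compPMap H.modularSqrt

/-- The eigenspace `ker (T - z)` of a partially defined operator. -/
def pmapEigenspace (T : E →ₗ.[ℂ] E) (z : ℂ) : Submodule ℂ T.domain :=
  LinearMap.ker (T.toFun - z • T.domain.subtype)

/-- The deficiency index `n⁺_U = dim ker (B_U^* - i)`. -/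
noncomputable def deficiencyPos (H : StandardSubspace E) (U : E ≃ₗᵢ[ℂ] E) : Cardinal :=
  Module.rank ℂ (pmapEigenspace (H.opB U).adjoint I)

/-- The deficiency index `n⁻_U = dim ker (B_U^* + i)`. -/
noncomputable def deficiencyNeg (H : StandardSubspace E) (U : E ≃ₗᵢ[ℂ] E) : Cardinal :=
  Module.rank ℂ (pmapEigenspace (H.opB U).adjoint (-I))

end StandardSubspace

-- Comparing real and complex dimensions.

universe u

/-! Write R = Δ_H^{1/2}, J = J_H. Then B_U^* = RU, so the deficiency spaces are the kernels of RU ∓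
i (`defectSpace`). For a symmetric endomorphism, RU extends U^*R (`IsEndomorphism.mem_graph`), so
B_U is a symmetric operator and von Neumann's arguments apply.

(a) If both kernels vanish, dom RU lies in dom R. Then U^* maps H into H, contradicting properness.
For the bound, send y = y₁ + y₂ with RUy_j = ±iy_j to Uy + JRUy ∈ H, then project off UH. If y and
(iy₁, iy₂) both go to 0, then Uy ∈ UH + iUH, so y ∈ dom R; but dom R and the two kernels are
linearly independent. So this real-linear map kills no complex line, which gives dim_ℂ of the source
≤ dim_ℝ of the target (`rank_complex_le_rank_real`).

(b) For U = V², one has RU - z = V^*(R - z)V on dom RV, and this is a bijection onto the whole space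
when R - z is one. Hence ker(RU - z) is a complement of dom RV in dom RU for each of z = i, -i, -1,
and the three dimensions agree (`IsEndomorphism.rank_defectSpace_sq`). The value z = -1 is the
useful one: if RUy = -y, then Uy - Jy lies in (UH)' ∩ H, and again no complex line is killed. -/

theorem two_mul_cardinal_le_cancel {a b : Cardinal} (h : 2 * a ≤ 2 * b) : a ≤ b := by
  rcases lt_or_ge b Cardinal.aleph0 with hb | hb
  · have ha : a < Cardinal.aleph0 := by
      refine lt_of_le_of_lt ?_ (lt_of_le_of_lt h
        (Cardinal.mul_lt_aleph0 (Cardinal.natCast_lt_aleph0 (n := 2)) hb))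
      exact Cardinal.le_mul_left two_ne_zero
    lift a to ℕ using ha
    lift b to ℕ using hb
    norm_cast at h ⊢
    omega
  · have : 2 * b = b := Cardinal.mul_eq_right hb
      ((Cardinal.natCast_lt_aleph0 (n := 2)).le.trans hb) two_ne_zero
    exact (Cardinal.le_mul_left two_ne_zero).trans (h.trans this.le)

/-- A real-linear map whose kernel contains no complex line bounds the complex dimension of its
source by the real dimension of its target. -/
theorem rank_complex_le_rank_real {K E : Type u} [AddCommGroup K] [Module ℂ K]
    [AddCommGroup E] [Module ℝ E] {N : Submodule ℝ E} (A : K → E) (hN : ∀ y, A y ∈ N)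
    (hadd : ∀ x y, A (x + y) = A x + A y) (hsmul : ∀ (r : ℝ) y, A ((r : ℂ) • y) = r • A y)
    (hA : ∀ y, A y = 0 → A (I • y) = 0 → y = 0) :
    Module.rank ℂ K ≤ Module.rank ℝ N := by
  let g : K →ₗ[ℝ] N :=
    { toFun := fun y => ⟨A y, hN y⟩
      map_add' := fun x y => Subtype.ext (hadd x y)
      map_smul' := fun r y =>
        Subtype.ext ((congrArg A (Complex.coe_smul r y).symm).trans (hsmul r y)) }
  -- The pair (A y, A (iy)) determines y, so 2 dim_ℂ K = dim_ℝ K ≤ 2 dim_ℝ N.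
  let f : K →ₗ[ℝ] N × N := g.prod (g ∘ₗ (LinearMap.lsmul ℂ K I).restrictScalars ℝ)
  have hf : Function.Injective f := (injective_iff_map_eq_zero f).2 fun y hy =>
    hA y (congrArg (fun p => (p.1 : E)) hy) (congrArg (fun p => (p.2 : E)) hy)
  have h := LinearMap.rank_le_of_injective f hf
  rw [rank_real_of_complex, rank_prod', ← two_mul] at h
  exact two_mul_cardinal_le_cancel h

/-! ### Positive self-adjoint operators through their graphs. -/

namespace LinearPMap

variable {E : Type*} [NormedAddCommGroup E] [InnerProductSpace ℂ E] [CompleteSpace E]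
  {R : E →ₗ.[ℂ] E}

theorem mem_graph_of_isSelfAdjoint (hR : IsSelfAdjoint R) {y z : E}
    (h : ∀ x w, (x, w) ∈ R.graph → ⟪w, y⟫ = ⟪x, z⟫) : (y, z) ∈ R.graph := by
  rw [← isSelfAdjoint_def.1 hR, adjoint_graph_eq_graph_adjoint hR.dense_domain,
    Submodule.mem_adjoint_iff]
  exact fun a b hab => sub_eq_zero.2 (h a b hab)

theorem inner_eq_of_mem_graph (hR : IsSelfAdjoint R) {x w y z : E} (hx : (x, w) ∈ R.graph)
    (hy : (y, z) ∈ R.graph) : ⟪w, y⟫ = ⟪x, z⟫ := by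
  rw [← isSelfAdjoint_def.1 hR, adjoint_graph_eq_graph_adjoint hR.dense_domain,
    Submodule.mem_adjoint_iff] at hy
  exact sub_eq_zero.1 (hy x w hx)

/-- For a self-adjoint `R`, the bounded operators `G = (1 + R²)⁻¹` and `F = R (1 + R²)⁻¹`. -/
theorem exists_graph_projection (hR : IsSelfAdjoint R) :
    ∃ G F : E →L[ℂ] E, ∀ x, (G x, F x) ∈ R.graph ∧ (F x, x - G x) ∈ R.graph := by
  let e := WithLp.prodContinuousLinearEquiv 2 ℂ E E
  let K : Submodule ℂ (WithLp 2 (E × E)) := R.graph.comap e.toLinearEquiv.toLinearMap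
  have hK : _root_.IsClosed (K : Set (WithLp 2 (E × E))) := hR.isClosed.preimage e.continuous
  have : CompleteSpace K := hK.completeSpace_coe
  let P := (e.toContinuousLinearMap ∘L K.starProjection) ∘L e.symm.toContinuousLinearMap ∘L
    ContinuousLinearMap.inl ℂ E E
  refine ⟨ContinuousLinearMap.fst ℂ E E ∘L P, ContinuousLinearMap.snd ℂ E E ∘L P, fun x => ?_⟩
  have h1 : P x ∈ R.graph := K.starProjection_apply_mem (e.symm (x, 0))
  refine ⟨h1, mem_graph_of_isSelfAdjoint hR fun y w hy => ?_⟩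
  -- (G x, F x) is the orthogonal projection of (x, 0) onto the graph. That the remainder (x - G x,
  -- -F x) is orthogonal to the graph says exactly that R^* sends F x to x - G x.
  have h2 := K.starProjection_inner_eq_zero (e.symm (x, 0)) (e.symm (y, w))
    (show e (e.symm (y, w)) ∈ R.graph by rwa [e.apply_symm_apply])
  have h3 : K.starProjection (e.symm (x, 0)) = e.symm (P x) := (e.symm_apply_apply _).symm
  rw [h3, ← inner_conj_symm, map_eq_zero] at h2
  have h4 : ⟪y, x - (P x).1⟫ + ⟪w, 0 - (P x).2⟫ = 0 :=
    (WithLp.prod_inner_apply _ _).symm.trans h2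
  rw [zero_sub, inner_neg_right] at h4
  exact (add_neg_eq_zero.1 h4).symm

variable {G F : E →L[ℂ] E}

/-- Splitting y = G y + R (F y) gives ⟪F x, y⟫ = ⟪R (G x), G y⟫ + ⟪F x, R (F y)⟫, and both terms
inherit symmetry and positivity from R. -/
theorem graph_projection_nonneg (hR : IsSelfAdjoint R)
    (hpos : ∀ x w, (x, w) ∈ R.graph → 0 ≤ (⟪w, x⟫).re)
    (h : ∀ x, (G x, F x) ∈ R.graph ∧ (F x, x - G x) ∈ R.graph) : 0 ≤ F := by
  have key (x y : E) : ⟪F x, y⟫ = ⟪F x, G y⟫ + ⟪F x, y - G y⟫ := by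
    rw [← inner_add_right, add_sub_cancel]
  refine StandardSubspace.aux_pos F (fun x y => ?_) fun x => ?_
  · rw [key, inner_eq_of_mem_graph hR (h x).1 (h y).1,
      ← inner_eq_of_mem_graph hR (h x).2 (h y).2, ← inner_add_left, add_sub_cancel]
  · rw [key, add_re, ← inner_eq_of_mem_graph hR (h x).2 (h x).2]
    exact add_nonneg (hpos _ _ (h x).1) (hpos _ _ (h x).2)

/-- The resolvent equation of a positive self-adjoint operator is solvable at `i`, `-i`, `-1`. -/
theorem exists_sub_smul_eq (hR : IsSelfAdjoint R)
    (hpos : ∀ x w, (x, w) ∈ R.graph → 0 ≤ (⟪w, x⟫).re) {z : ℂ}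
    (hz : z = I ∨ z = -I ∨ z = -1) (e : E) : ∃ x w, (x, w) ∈ R.graph ∧ w - z • x = e := by
  obtain ⟨G, F, h⟩ := exists_graph_projection hR
  have hz2 {z : ℂ} (hz : z * z = -1) : ∃ x w, (x, w) ∈ R.graph ∧ w - z • x = e := by
    -- For z² = -1 the resolvent (R - z)⁻¹ is (R + z)(1 + R²)⁻¹ = F + zG.
    refine ⟨F e + z • G e, e - G e + z • F e,
      add_mem (h e).2 (R.graph.smul_mem z (h e).1), ?_⟩
    rw [smul_add, smul_smul, hz, neg_one_smul]
    abel
  rcases hz with rfl | rfl | rfl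
  · exact hz2 (by simp)
  · exact hz2 (by simp)
  · have hF := graph_projection_nonneg hR hpos h
    -- Since (1 + R)(G + F) = 1 + 2F, it suffices to invert 1 + 2F, which is bounded below because F
    -- ≥ 0.
    have hu : IsUnit (1 + (2 : ℂ) • F) := by
      refine ContinuousLinearMap.isUnit_of_forall_le_norm_inner_map _ (c := 1) one_pos fun x => ?_
      have h1 := StandardSubspace.aux_re hF x
      have h2 : (⟪(1 + (2 : ℂ) • F) x, x⟫).re = ‖x‖ ^ 2 + 2 * (⟪F x, x⟫).re := by
        have : (⟪x, x⟫).re = ‖x‖ ^ 2 := inner_self_eq_norm_sq (𝕜 := ℂ) x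
        change (⟪x + (2 : ℂ) • F x, x⟫).re = _
        rw [inner_add_left, add_re, this, inner_smul_left]
        simp
      refine le_trans ?_ (Complex.re_le_norm _)
      rw [h2]
      simp
      linarith
    obtain ⟨u, hu⟩ := ((ContinuousLinearMap.isUnit_iff_bijective).1 hu).2 e
    refine ⟨G u + F u, F u + (u - G u), add_mem (h u).1 (h u).2, ?_⟩
    rw [← hu]
    change _ = u + (2 : ℂ) • F u
    rw [two_smul, neg_one_smul]
    abel

theorem eq_zero_of_mem_graph_smul (hR : IsSelfAdjoint R)
    (hpos : ∀ x w, (x, w) ∈ R.graph → 0 ≤ (⟪w, x⟫).re) {z : ℂ}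
    (hz : z = I ∨ z = -I ∨ z = -1) {x : E} (hx : (x, z • x) ∈ R.graph) : x = 0 := by
  have h1 := inner_eq_of_mem_graph hR hx hx
  have h2 := hpos _ _ hx
  rw [← inner_self_eq_zero (𝕜 := ℂ)]
  have h3 : ⟪x, x⟫ = ((‖x‖ ^ 2 : ℝ) : ℂ) := by
    rw [inner_self_eq_norm_sq_to_K]; norm_cast
  rw [inner_smul_left, inner_smul_right] at h1
  rw [inner_smul_left] at h2
  rw [h3] at h1 h2 ⊢
  have h4 := congrArg Complex.im h1
  have h5 : ‖x‖ ^ 2 = 0 := by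
    rcases hz with rfl | rfl | rfl
    · simp [-ofReal_pow] at h4
      linarith
    · simp [-ofReal_pow] at h4
      linarith
    · simp [-ofReal_pow] at h2
      simpa using h2
  rw [h5, ofReal_zero]

end LinearPMap

/-! ### The modular conjugation and the graph of Δ^{1/2}. -/

namespace StandardSubspace

variable {E : Type*} [NormedAddCommGroup E] [InnerProductSpace ℂ E]

theorem inner_antiunitary (J : E ≃ₗᵢ⋆[ℂ] E) (x y : E) : ⟪J x, J y⟫ = ⟪y, x⟫ := by
  refine Complex.ext ?_ ?_
  · rw [aux_inner, ← inner_conj_symm, conj_re]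
  · have h := aux_inner J x (I • y)
    rw [map_smulₛₗ, conj_I, neg_smul, inner_neg_right, neg_re,
      ← neg_eq_iff_eq_neg.2 (aux_im _ _)] at h
    rw [← inner_conj_symm y x, conj_im, aux_im x y, ← h, neg_neg, neg_neg]

theorem inner_antiunitary_symm (J : E ≃ₗᵢ⋆[ℂ] E) (x y : E) : ⟪J x, y⟫ = ⟪J.symm y, x⟫ := by
  simpa using inner_antiunitary J x (J.symm y)

theorem compPMap_eq_iff_graph {J : E ≃ₗᵢ⋆[ℂ] E} {R : E →ₗ.[ℂ] E} {S : E →ₛₗ.[starRingEnd ℂ] E}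
    (e : S = J.toLinearEquiv.toLinearMap.compPMap R) {x w : E} :
    (x, w) ∈ R.graph ↔ ∃ y : S.domain, (y : E) = x ∧ S y = J w := by
  subst e
  rw [LinearPMap.mem_graph_iff]
  exact exists_congr fun y => and_congr_right fun _ => J.injective.eq_iff.symm

theorem mem_image_iff (H : StandardSubspace E) (U : E ≃ₗᵢ[ℂ] E) {x : E} :
    x ∈ H.image U ↔ U.symm x ∈ H.toClosedSubmodule :=
  ClosedSubmodule.mem_mapEquiv_iff _ _ _

theorem IsEndomorphism.apply_mem {H : StandardSubspace E} {U : E ≃ₗᵢ[ℂ] E}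
    (hE : H.IsEndomorphism U) {x : E}
    (hx : x ∈ H.toClosedSubmodule) : U x ∈ H.toClosedSubmodule :=
  hE ((H.mem_image_iff U).2 (by rwa [U.symm_apply_apply]))

theorem IsProperEndomorphism.not_forall_symm_apply_mem {H : StandardSubspace E}
    {U : E ≃ₗᵢ[ℂ] E} (hP : H.IsProperEndomorphism U) :
    ¬ ∀ x ∈ H.toClosedSubmodule, U.symm x ∈ H.toClosedSubmodule := fun h =>
  hP.not_ge fun x hx => (H.mem_image_iff U).2 (h x hx)

variable [CompleteSpace E] (H : StandardSubspace E)

theorem modularSqrt_inner_nonneg {x w : E} (h : (x, w) ∈ H.modularSqrt.graph) :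
    0 ≤ (⟪w, x⟫).re := by
  obtain ⟨y, rfl, rfl⟩ := (LinearPMap.mem_graph_iff _).1 h
  exact H.isPolarDecomposition_tomita.nonneg y

theorem mem_graph_modularSqrt_iff {x w : E} : (x, w) ∈ H.modularSqrt.graph ↔
    ∃ h ∈ H.toClosedSubmodule, ∃ k ∈ H.toClosedSubmodule,
      x = h + I • k ∧ H.modularConj w = h - I • k := by
  rw [compPMap_eq_iff_graph H.isPolarDecomposition_tomita.eq_comp]
  constructor
  · rintro ⟨y, hy, hw⟩
    obtain ⟨h, hh, k, hk, e⟩ := y.2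
    exact ⟨h, hh, k, hk, hy.symm.trans e, hw.symm.trans (H.tomita_apply y hh hk e)⟩
  · rintro ⟨h, hh, k, hk, e, e'⟩
    exact ⟨⟨x, h, hh, k, hk, e⟩, rfl, (H.tomita_apply _ hh hk e).trans e'.symm⟩

theorem isSelfAdjoint_modularSqrt : IsSelfAdjoint H.modularSqrt :=
  H.isPolarDecomposition_tomita.isSelfAdjoint

/-- This is S² = 1 for S = JR: with w = Rx it reads RJRx = J⁻¹x. It is stated with J⁻¹ because J² =
1 is deduced from it. -/
theorem mem_graph_swap_symm {x w : E} (h : (x, w) ∈ H.modularSqrt.graph) :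
    (H.modularConj w, H.modularConj.symm x) ∈ H.modularSqrt.graph := by
  obtain ⟨h, hh, k, hk, e, e'⟩ := H.mem_graph_modularSqrt_iff.1 h
  refine H.mem_graph_modularSqrt_iff.2 ⟨h, hh, -k,
    H.toClosedSubmodule.toSubmodule.neg_mem hk, ?_, ?_⟩
  · rw [e', smul_neg, sub_eq_add_neg]
  · rw [H.modularConj.apply_symm_apply, e, smul_neg, sub_neg_eq_add]

/-- Obtained from `mem_graph_swap_symm` by passing to adjoints, which exchanges J and J⁻¹. -/
theorem mem_graph_symm_swap {x w : E} (h : (x, w) ∈ H.modularSqrt.graph) :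
    (H.modularConj.symm w, H.modularConj x) ∈ H.modularSqrt.graph := by
  refine LinearPMap.mem_graph_of_isSelfAdjoint H.isSelfAdjoint_modularSqrt fun a b hab => ?_
  have hs := LinearPMap.inner_eq_of_mem_graph H.isSelfAdjoint_modularSqrt
    (H.mem_graph_swap_symm hab) h
  rw [← inner_conj_symm, ← inner_antiunitary_symm, ← hs, ← inner_antiunitary_symm, inner_conj_symm]

theorem modularConj_modularConj (x : E) : H.modularConj (H.modularConj x) = x := by
  set J := H.modularConj
  have hR := H.isSelfAdjoint_modularSqrt
  obtain ⟨G, F, h⟩ := LinearPMap.exists_graph_projection hR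
  have hF : 0 ≤ F :=
    LinearPMap.graph_projection_nonneg hR (fun _ _ => H.modularSqrt_inner_nonneg) h
  -- M = J²F is positive by the two swap relations, and M² = M^*M = F² because J² is isometric.
  -- Uniqueness of positive square roots gives J²F = F, and injectivity of F together with its
  -- self-adjointness removes F.
  let M : E →L[ℂ] E := (J.trans J).toContinuousLinearEquiv.toContinuousLinearMap ∘L F
  have hMx (x : E) : M x = J (J (F x)) := rfl
  have key (x y : E) : ⟪M x, y⟫ = ⟪J.symm (G y), J (F x)⟫ + ⟪J.symm (y - G y), J (F x)⟫ := by
    rw [hMx, inner_antiunitary_symm, ← inner_add_left, ← map_add, add_sub_cancel]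
  have hM : 0 ≤ M := by
    refine aux_pos M (fun x y => ?_) fun x => ?_
    · rw [key, LinearPMap.inner_eq_of_mem_graph hR (H.mem_graph_swap_symm (h y).1)
        (H.mem_graph_swap_symm (h x).1),
        ← LinearPMap.inner_eq_of_mem_graph hR (H.mem_graph_symm_swap (h y).2)
        (H.mem_graph_symm_swap (h x).2), ← inner_add_right, ← map_add, add_sub_cancel,
        ← inner_conj_symm, ← inner_antiunitary_symm, inner_conj_symm, hMx]
    · rw [key, add_re]
      exact add_nonneg (H.modularSqrt_inner_nonneg (H.mem_graph_swap_symm (h x).1))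
        (by
          have := H.modularSqrt_inner_nonneg (H.mem_graph_symm_swap (h x).2)
          rwa [← inner_conj_symm, conj_re])
  have hMM : M * M = F * F := by
    ext x
    refine ext_inner_right ℂ fun y => ?_
    change ⟪M (M x), y⟫ = ⟪F (F x), y⟫
    rw [aux_sa hM, aux_sa hF, hMx, hMx, inner_antiunitary, inner_antiunitary]
  have hMF : M = F := by rw [← CFC.sqrt_mul_self M hM, hMM, CFC.sqrt_mul_self F hF]
  have hFinj (x : E) (hx : F x = 0) : x = 0 := by
    obtain ⟨h1, h2⟩ := h x
    rw [hx] at h1 h2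
    have h3 := H.modularSqrt.graph_fst_eq_zero_snd h2 rfl
    rw [← sub_eq_zero.1 h3] at h1
    have h4 := H.modularSqrt.graph_fst_eq_zero_snd (H.mem_graph_swap_symm h1) (map_zero _)
    simpa using h4
  have hsymm (y : E) : J.symm (J.symm y) = y := by
    refine sub_eq_zero.1 (hFinj _ (ext_inner_left ℂ fun x => ?_))
    rw [← aux_sa hF, inner_zero_right, inner_sub_right, sub_eq_zero]
    nth_rewrite 2 [← hMF]
    rw [hMx, ← inner_antiunitary J, J.apply_symm_apply, ← inner_antiunitary J,
      J.apply_symm_apply]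
  rw [← hsymm (J (J x)), J.symm_apply_apply, J.symm_apply_apply]

theorem modularConj_symm (x : E) : H.modularConj.symm x = H.modularConj x := by
  rw [← H.modularConj_modularConj (H.modularConj.symm x), H.modularConj.apply_symm_apply]

theorem mem_graph_swap {x w : E} (h : (x, w) ∈ H.modularSqrt.graph) :
    (H.modularConj w, H.modularConj x) ∈ H.modularSqrt.graph := by
  rw [← H.modularConj_symm x]
  exact H.mem_graph_swap_symm h

/-- H is the fixed space of S, and since J² = 1 the equation JRx = x means Rx = Jx. -/
theorem mem_iff_graph {x : E} :
    x ∈ H.toClosedSubmodule ↔ (x, H.modularConj x) ∈ H.modularSqrt.graph := by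
  rw [mem_graph_modularSqrt_iff]
  constructor
  · intro h
    exact ⟨x, h, 0, zero_mem H.toClosedSubmodule.toSubmodule, by simp,
      by simp [H.modularConj_modularConj]⟩
  · rintro ⟨h, hh, k, hk, rfl, e'⟩
    rw [modularConj_modularConj, sub_eq_add_neg, add_right_inj, ← smul_neg] at e'
    have e'' := smul_right_injective E I_ne_zero e'
    have e''' : k = 0 := by
      have : (2 : ℂ) • k = 0 := by rw [two_smul]; nth_rewrite 2 [e'']; exact add_neg_cancel k
      exact (smul_eq_zero.1 this).resolve_left two_ne_zero
    rwa [e''', smul_zero, add_zero]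

theorem modularConj_apply_symmetric {U : E ≃ₗᵢ[ℂ] E} (hU : U = H.sharp U) (x : E) :
    H.modularConj (U x) = U.symm (H.modularConj x) := by
  nth_rewrite 1 [hU]
  exact H.modularConj_modularConj _

theorem modularConj_symm_apply_symmetric {U : E ≃ₗᵢ[ℂ] E} (hU : U = H.sharp U) (x : E) :
    H.modularConj (U.symm x) = U (H.modularConj x) := by
  rw [← H.modularConj_modularConj (U _), H.modularConj_apply_symmetric hU,
    H.modularConj_modularConj]

/-! ### Deficiency spaces of B_U. -/

/-- (U^*R)^* = RU, because U is unitary and R is self-adjoint. -/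
theorem mem_graph_adjoint_opB_iff (U : E ≃ₗᵢ[ℂ] E) {y z : E} :
    (y, z) ∈ (H.opB U).adjoint.graph ↔ (U y, z) ∈ H.modularSqrt.graph := by
  have hR := H.isSelfAdjoint_modularSqrt
  have hB {x w : E} : (x, w) ∈ (H.opB U).graph ↔ (x, U w) ∈ H.modularSqrt.graph := by
    rw [LinearPMap.mem_graph_iff, LinearPMap.mem_graph_iff]
    exact exists_congr fun y => and_congr_right fun _ => U.symm_apply_eq
  have hd : Dense ((H.opB U).domain : Set E) := hR.dense_domain
  rw [LinearPMap.adjoint_graph_eq_graph_adjoint hd, Submodule.mem_adjoint_iff]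
  constructor
  · intro h
    refine LinearPMap.mem_graph_of_isSelfAdjoint hR fun x w hx => ?_
    have := h x (U.symm w) (hB.2 (by rwa [U.apply_symm_apply]))
    rw [sub_eq_zero] at this
    rw [← this, ← U.inner_map_map (U.symm w), U.apply_symm_apply]
  · intro h a b hab
    rw [sub_eq_zero, ← LinearPMap.inner_eq_of_mem_graph hR (hB.1 hab) h, U.inner_map_map]

/-- The eigenspace of `Δ^{1/2} U = (U^* Δ^{1/2})^*` for the eigenvalue `z`, in the ambient space. -/
noncomputable def defectSpace (U : E ≃ₗᵢ[ℂ] E) (z : ℂ) : Submodule ℂ E :=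
  H.modularSqrt.graph.comap (U.toLinearEquiv.toLinearMap.prod (z • LinearMap.id))

theorem mem_defectSpace_iff {U : E ≃ₗᵢ[ℂ] E} {z : ℂ} {y : E} :
    y ∈ H.defectSpace U z ↔ (U y, z • y) ∈ H.modularSqrt.graph :=
  Iff.rfl

theorem rank_pmapEigenspace_adjoint_opB (U : E ≃ₗᵢ[ℂ] E) (z : ℂ) :
    Module.rank ℂ (pmapEigenspace (H.opB U).adjoint z) = Module.rank ℂ (H.defectSpace U z) := by
  have h : (pmapEigenspace (H.opB U).adjoint z).map (H.opB U).adjoint.domain.subtype =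
      H.defectSpace U z := by
    ext y
    rw [mem_defectSpace_iff, ← mem_graph_adjoint_opB_iff, LinearPMap.mem_graph_iff,
      Submodule.mem_map]
    constructor
    · rintro ⟨y, hy, rfl⟩
      exact ⟨y, rfl, sub_eq_zero.1 hy⟩
    · rintro ⟨y, rfl, hy⟩
      exact ⟨y, sub_eq_zero.2 hy, rfl⟩
  rw [← h]
  exact (Submodule.equivMapOfInjective _ (Submodule.subtype_injective _) _).rank_eq

/-! ### Symmetric endomorphisms and the bound for the real orthogonal complement. -/

section Symmetric

variable {H} {U : E ≃ₗᵢ[ℂ] E}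

/-- U preserves H + iH and commutes with S = JR there; moving U past J by symmetry turns it into
U^*, whence U^*R ⊆ RU. -/
theorem IsEndomorphism.mem_graph (hE : H.IsEndomorphism U) (hU : U = H.sharp U) {x w : E}
    (h : (x, w) ∈ H.modularSqrt.graph) : (U x, U.symm w) ∈ H.modularSqrt.graph := by
  obtain ⟨h, hh, k, hk, e, e'⟩ := H.mem_graph_modularSqrt_iff.1 h
  refine H.mem_graph_modularSqrt_iff.2 ⟨U h, hE.apply_mem hh, U k, hE.apply_mem hk, ?_, ?_⟩
  · rw [e, map_add, map_smul]
  · rw [H.modularConj_symm_apply_symmetric hU, e', map_sub, map_smul]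

/-- For x ∈ H, applying U^*R ⊆ RU to U^*x gives U^*RU^*x = Rx = Jx. So RU^*x = UJx = JU^*x, the
criterion for U^*x ∈ H. -/
theorem IsEndomorphism.symm_apply_mem (hE : H.IsEndomorphism U) (hU : U = H.sharp U)
    (hD : ∀ x w, (x, w) ∈ H.modularSqrt.graph → ∃ w', (U.symm x, w') ∈ H.modularSqrt.graph)
    {x : E} (hx : x ∈ H.toClosedSubmodule) : U.symm x ∈ H.toClosedSubmodule := by
  obtain ⟨w, hw⟩ := hD _ _ (H.mem_iff_graph.1 hx)
  have h1 := hE.mem_graph hU hw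
  rw [U.apply_symm_apply] at h1
  have h2 := H.modularSqrt.mem_graph_snd_inj h1 (H.mem_iff_graph.1 hx) rfl
  rw [mem_iff_graph, H.modularConj_symm_apply_symmetric hU, ← h2,
    U.apply_symm_apply]
  exact hw

/-- A symmetric endomorphism with trivial defect spaces is invertible on `dom Δ^{1/2}`. -/
theorem IsEndomorphism.mem_domain_of_defectSpace_eq_bot (hE : H.IsEndomorphism U)
    (hU : U = H.sharp U) (h₁ : H.defectSpace U I = ⊥) (h₂ : H.defectSpace U (-I) = ⊥) {m w : E}
    (hm : (U m, w) ∈ H.modularSqrt.graph) : ∃ w', (m, w') ∈ H.modularSqrt.graph := by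
  obtain ⟨G, F, h⟩ := LinearPMap.exists_graph_projection H.isSelfAdjoint_modularSqrt
  -- Decompose (m, Uw) orthogonally along the graph of R: (x, r) is the component in the graph and
  -- (u, k) the orthogonal one, so Rk = -u.
  have hx := add_mem (h m).1 (h (U w)).2
  have hk := sub_mem (h (U w)).1 (h m).2
  rw [Prod.mk_add_mk] at hx
  rw [Prod.mk_sub_mk] at hk
  set x := G m + F (U w) with hxd
  set r := F m + (U w - G (U w)) with hrd
  set k := G (U w) - F m with hkd
  have hu := sub_mem hm (hE.mem_graph hU hx)
  rw [Prod.mk_sub_mk, ← map_sub] at hu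
  have hv : U.symm k = w - U.symm r := by
    have : k = U w - r := by rw [hkd, hrd]; abel
    rw [this, map_sub, U.symm_apply_apply]
  rw [← hv] at hu
  have hk' : F (U w) - (m - G m) = -(m - x) := by rw [hxd]; abel
  rw [hk', ← U.apply_symm_apply k] at hk
  set u := m - x
  set v := U.symm k
  -- Now RUu = v and RUv = -u, so v ± iu are eigenvectors of RU for ±i.
  have e₁ : v + I • u = 0 := by
    rw [← Submodule.mem_bot ℂ, ← h₁, mem_defectSpace_iff]
    convert add_mem hk (H.modularSqrt.graph.smul_mem I hu) using 1
    simp [smul_smul, add_comm]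
  have e₂ : v - I • u = 0 := by
    rw [← Submodule.mem_bot ℂ, ← h₂, mem_defectSpace_iff]
    convert sub_mem hk (H.modularSqrt.graph.smul_mem I hu) using 1
    simp [smul_smul, smul_sub]
    abel
  have e₃ : (2 * I) • u = 0 := by
    have : (2 * I) • u = (v + I • u) - (v - I • u) := by rw [mul_smul, two_smul]; abel
    rw [this, e₁, e₂, sub_zero]
  have e₄ : u = 0 := (smul_eq_zero.1 e₃).resolve_left (by simp)
  exact ⟨r, by rwa [sub_eq_zero.1 e₄]⟩

theorem IsProperEndomorphism.rank_defectSpace_pos (hP : H.IsProperEndomorphism U)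
    (hU : U = H.sharp U) :
    0 < Module.rank ℂ (H.defectSpace U I) + Module.rank ℂ (H.defectSpace U (-I)) := by
  have hE : H.IsEndomorphism U := hP.le
  refine pos_iff_ne_zero.2 fun h => hP.not_forall_symm_apply_mem fun x hx =>
    hE.symm_apply_mem hU (fun x w hx => ?_) hx
  rw [add_eq_zero, Submodule.rank_eq_zero, Submodule.rank_eq_zero] at h
  exact hE.mem_domain_of_defectSpace_eq_bot hU h.1 h.2
    (by rwa [U.apply_symm_apply])

/-- The two defect spaces of the symmetric operator `U^* Δ^{1/2}` and its domain are linearly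
independent. -/
theorem IsEndomorphism.eq_zero_of_add_mem_domain (hE : H.IsEndomorphism U) (hU : U = H.sharp U)
    {y₁ y₂ w : E} (h₁ : y₁ ∈ H.defectSpace U I) (h₂ : y₂ ∈ H.defectSpace U (-I))
    (hy : (y₁ + y₂, w) ∈ H.modularSqrt.graph) : y₁ = 0 ∧ y₂ = 0 := by
  have hR := H.isSelfAdjoint_modularSqrt
  rw [mem_defectSpace_iff] at h₁ h₂
  have h3 : U.symm w = I • y₁ + (-I) • y₂ := by
    have h4 := add_mem h₁ h₂
    rw [Prod.mk_add_mk, ← map_add] at h4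
    exact H.modularSqrt.mem_graph_snd_inj (hE.mem_graph hU hy) h4 rfl
  -- Pairing y₁ + y₂ with each y_j through the self-adjointness of R makes the cross terms cancel
  -- and leaves a nonzero multiple of ‖y_j‖².
  have e (y : E) : ⟪U y, w⟫ = ⟪y, I • y₁ + (-I) • y₂⟫ := by
    rw [← h3, ← U.inner_map_map y, U.apply_symm_apply]
  have e₁ := LinearPMap.inner_eq_of_mem_graph hR h₁ hy
  have e₂ := LinearPMap.inner_eq_of_mem_graph hR h₂ hy
  rw [e] at e₁ e₂
  simp only [inner_add_right, inner_smul_left, inner_smul_right, conj_I, map_neg] at e₁ e₂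
  rw [← inner_self_eq_zero (𝕜 := ℂ), ← inner_self_eq_zero (𝕜 := ℂ) (x := y₂)]
  constructor
  · have : (-2 * I) * ⟪y₁, y₁⟫ = 0 := by linear_combination e₁
    exact (mul_eq_zero.1 this).resolve_left (by simp)
  · have : (2 * I) * ⟪y₂, y₂⟫ = 0 := by linear_combination e₂
    exact (mul_eq_zero.1 this).resolve_left (by simp)

theorem modularConj_real_smul (r : ℝ) (x : E) :
    H.modularConj ((r : ℂ) • x) = (r : ℂ) • H.modularConj x := by
  rw [map_smulₛₗ, conj_ofReal]

/-- For x = h + ik this vector is x + Sx = 2h. -/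
theorem mem_of_mem_graph_add {x w : E} (h : (x, w) ∈ H.modularSqrt.graph) :
    x + H.modularConj w ∈ H.toClosedSubmodule := by
  rw [mem_iff_graph]
  convert add_mem h (H.mem_graph_swap h) using 1
  rw [map_add, modularConj_modularConj, Prod.mk_add_mk, add_comm w]

theorem IsEndomorphism.rank_defectSpace_add_le (hE : H.IsEndomorphism U) (hU : U = H.sharp U) :
    Module.rank ℂ (H.defectSpace U I) + Module.rank ℂ (H.defectSpace U (-I)) ≤
      Module.rank ℝ ((H.image U)ᗮ ⊓ H.toClosedSubmodule).toSubmodule := by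
  let K : Submodule ℝ E := (H.image U).toSubmodule
  have hKc : IsClosed (K : Set E) := (H.image U).isClosed
  have : CompleteSpace K := hKc.completeSpace_coe
  let P : E →L[ℝ] E := K.starProjection
  let J := H.modularConj
  let g : E × E → E := fun y => U (y.1 + y.2) + J (I • y.1 + (-I) • y.2)
  have hg (y : H.defectSpace U I × H.defectSpace U (-I)) :
      (U (y.1 + y.2), I • (y.1 : E) + (-I) • (y.2 : E)) ∈ H.modularSqrt.graph := by
    rw [map_add]
    exact H.modularSqrt.graph.add_mem y.1.2 y.2.2
  have hgI (y : E × E) : g (I • y) = I • (U (y.1 + y.2) - J (I • y.1 + (-I) • y.2)) := by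
    simp only [g, Prod.smul_fst, Prod.smul_snd]
    rw [← smul_add, map_smul, smul_comm (-I), ← smul_add, map_smulₛₗ, conj_I, smul_sub, neg_smul,
      sub_eq_add_neg]
  have hP0 (x : E) (hx : x - P x = 0) : U.symm x ∈ H.toClosedSubmodule :=
    (H.mem_image_iff U).1 (K.starProjection_eq_self_iff.1 (sub_eq_zero.1 hx).symm)
  rw [← rank_prod']
  refine rank_complex_le_rank_real
    (fun y : H.defectSpace U I × H.defectSpace U (-I) => g (y.1, y.2) - P (g (y.1, y.2)))
    (fun y => ?_) (fun x y => ?_) (fun r y => ?_) fun y h₁ h₂ => ?_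
  · refine ⟨?_, ?_⟩
    · exact K.sub_starProjection_mem_orthogonal _
    · exact H.toClosedSubmodule.toSubmodule.sub_mem (mem_of_mem_graph_add (hg y))
        (hE (K.starProjection_apply_mem _))
  · have : g ((x + y).1, (x + y).2) = g (x.1, x.2) + g (y.1, y.2) := by
      simp only [g, Prod.fst_add, Prod.snd_add, Submodule.coe_add, smul_add, map_add]
      abel
    rw [this, map_add]
    abel
  · have : g (((r : ℂ) • y).1, ((r : ℂ) • y).2) = r • g (y.1, y.2) := by
      simp only [g, Prod.smul_fst, Prod.smul_snd, Submodule.coe_smul]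
      rw [smul_comm I, smul_comm (-I), ← smul_add, ← smul_add, map_smul, modularConj_real_smul,
        ← smul_add, Complex.coe_smul]
    rw [this, map_smul, smul_sub]
  · have h₃ := hP0 _ h₁
    have h₄ := hP0 _ h₂
    have h₅ : g (((I • y).1 : E), ((I • y).2 : E)) = g (I • ((y.1 : E), (y.2 : E))) := rfl
    rw [h₅, hgI] at h₄
    have h₆ := sub_mem (H.mem_iff_graph.1 h₃)
      (H.modularSqrt.graph.smul_mem I (H.mem_iff_graph.1 h₄))
    have h₇ := H.modularSqrt.graph.smul_mem (2⁻¹ : ℂ) h₆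
    rw [Prod.smul_mk, Prod.mk_sub_mk, Prod.smul_mk] at h₇
    -- J is antilinear, so g(y) - i g(iy) = 2U(y₁ + y₂): the J-terms cancel. Both U^*g(y) and
    -- U^*g(iy) lie in H, hence y₁ + y₂ ∈ H + iH = dom R.
    have h₈ : (2⁻¹ : ℂ) • (U.symm (g (y.1, y.2)) - I • U.symm (I • (U (y.1 + y.2) -
        J (I • (y.1 : E) + (-I) • (y.2 : E))))) = y.1 + y.2 := by
      rw [map_smul, smul_smul, I_mul_I, neg_one_smul, sub_neg_eq_add, ← map_add]
      simp only [g]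
      rw [add_add_sub_cancel, ← two_smul ℂ, ← map_smul, smul_smul]
      norm_num
    rw [h₈] at h₇
    obtain ⟨h₉, h₁₀⟩ := hE.eq_zero_of_add_mem_domain hU y.1.2 y.2.2 h₇
    exact Prod.ext (Subtype.ext h₉) (Subtype.ext h₁₀)

/-! ### Squares of symmetric endomorphisms. -/

section Square

variable {V : E ≃ₗᵢ[ℂ] E}

theorem sharp_sq (hV : V = H.sharp V) : V ^ 2 = H.sharp (V ^ 2) := by
  ext x
  change V (V x) = H.modularConj (V.symm (V.symm (H.modularConj x)))
  rw [H.modularConj_symm_apply_symmetric hV, H.modularConj_symm_apply_symmetric hV,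
    modularConj_modularConj]

/-- The right-hand side, dom RV² modulo dom RV, does not involve z; this is how the three
eigenvalues are compared. -/
theorem IsEndomorphism.rank_defectSpace_sq (hE : H.IsEndomorphism V) (hV : V = H.sharp V) {z : ℂ}
    (hz : z = I ∨ z = -I ∨ z = -1) : Module.rank ℂ (H.defectSpace (V ^ 2) z) =
      Module.rank ℂ (H.modularSqrt.domain.comap (V ^ 2).toLinearEquiv.toLinearMap ⧸
        (H.modularSqrt.domain.comap V.toLinearEquiv.toLinearMap).submoduleOf
          (H.modularSqrt.domain.comap (V ^ 2).toLinearEquiv.toLinearMap)) := by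
  have hR := H.isSelfAdjoint_modularSqrt
  have hp : ∀ x w, (x, w) ∈ H.modularSqrt.graph → 0 ≤ (⟪w, x⟫).re :=
    fun _ _ => H.modularSqrt_inner_nonneg
  set M := H.modularSqrt.domain.comap (V ^ 2).toLinearEquiv.toLinearMap
  set N := H.modularSqrt.domain.comap V.toLinearEquiv.toLinearMap
  have hM {y : E} : y ∈ M ↔ ∃ w, (V (V y), w) ∈ H.modularSqrt.graph := LinearPMap.mem_domain_iff
  have hN {y : E} : y ∈ N ↔ ∃ w, (V y, w) ∈ H.modularSqrt.graph := LinearPMap.mem_domain_iff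
  have hle : H.defectSpace (V ^ 2) z ≤ M := fun y hy => hM.2 ⟨_, hy⟩
  have hc : IsCompl (N.submoduleOf M) ((H.defectSpace (V ^ 2) z).submoduleOf M) := by
    constructor
    · refine Submodule.disjoint_def.2 ?_
      rintro ⟨y, hyM⟩ hy hy'
      obtain ⟨w, hw⟩ := hN.1 hy
      have h1 : (V (V y), z • y) ∈ H.modularSqrt.graph := hy'
      have h2 := H.modularSqrt.mem_graph_snd_inj (hE.mem_graph hV hw) h1 rfl
      have h3 : w = z • V y := by
        rw [← map_smul, ← V.symm_apply_eq]
        exact h2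
      rw [h3] at hw
      have h4 := LinearPMap.eq_zero_of_mem_graph_smul hR hp hz hw
      exact Subtype.ext (V.map_eq_zero_iff.1 h4)
    · rw [codisjoint_iff, Submodule.eq_top_iff']
      rintro ⟨y, hy⟩
      obtain ⟨w, hw⟩ := hM.1 hy
      -- V^*x ∈ dom RV is chosen so that RV² - z takes the same value on it as on y; the difference
      -- then lies in the kernel.
      obtain ⟨x, s, hx, hs⟩ := LinearPMap.exists_sub_smul_eq hR hp hz (V (w - z • y))
      have h1 : (V (V (V.symm x)), V.symm s) ∈ H.modularSqrt.graph := by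
        rw [V.apply_symm_apply]
        exact hE.mem_graph hV hx
      have h2 : V.symm s - z • V.symm x = w - z • y := by
        rw [← map_smul, ← map_sub, hs, V.symm_apply_apply]
      have hn : V.symm x ∈ N := hN.2 ⟨s, by rwa [V.apply_symm_apply]⟩
      have hn' : V.symm x ∈ M := hM.2 ⟨_, h1⟩
      refine Submodule.mem_sup.2 ⟨⟨V.symm x, hn'⟩, hn, ⟨y - V.symm x, sub_mem hy hn'⟩, ?_,
        Subtype.ext (add_sub_cancel _ _)⟩
      change (V (V (y - V.symm x)), z • (y - V.symm x)) ∈ H.modularSqrt.graph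
      convert sub_mem hw h1 using 1
      rw [Prod.mk_sub_mk, map_sub, map_sub, smul_sub]
      congr 1
      rw [sub_eq_sub_iff_add_eq_add] at h2 ⊢
      rw [add_comm, h2.symm, add_comm]
  rw [(Submodule.quotientEquivOfIsCompl _ _ hc).rank_eq]
  exact (Submodule.submoduleOfEquivOfLe hle).rank_eq.symm

theorem IsEndomorphism.rank_defectSpace_sq_pos (hE : H.IsEndomorphism V) (hV : V = H.sharp V)
    (hP : H.IsProperEndomorphism (V ^ 2)) : 0 < Module.rank ℂ (H.defectSpace (V ^ 2) I) := by
  refine pos_iff_ne_zero.2 fun h => hP.not_forall_symm_apply_mem fun x hx => ?_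
  rw [hE.rank_defectSpace_sq hV (Or.inl rfl), rank_zero_iff, Submodule.Quotient.subsingleton_iff,
    Submodule.submoduleOf, Submodule.comap_subtype_eq_top] at h
  -- A zero defect means dom RV² ⊆ dom RV; evaluating at V⁻²x shows that V^* preserves dom R.
  have hD : ∀ x w, (x, w) ∈ H.modularSqrt.graph → ∃ w', (V.symm x, w') ∈ H.modularSqrt.graph := by
    intro x w hx
    have h1 : V.symm (V.symm x) ∈ H.modularSqrt.domain.comap V.toLinearEquiv.toLinearMap := by
      refine h (LinearPMap.mem_domain_iff.2 ⟨w, ?_⟩)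
      change (V (V (V.symm (V.symm x))), w) ∈ _
      rwa [V.apply_symm_apply, V.apply_symm_apply]
    obtain ⟨w', hw'⟩ := LinearPMap.mem_domain_iff.1 h1
    refine ⟨w', ?_⟩
    rw [← V.apply_symm_apply (V.symm x)]
    exact hw'
  exact hE.symm_apply_mem hV hD (hE.symm_apply_mem hV hD hx)

end Square

/-! ### The eigenvalue -1 and the symplectic complement. -/

theorem rank_defectSpace_neg_one_le (hU : U = H.sharp U) :
    Module.rank ℂ (H.defectSpace U (-1)) ≤
      Module.rank ℝ ((H.image U).symplComp ⊓ H.toClosedSubmodule).toSubmodule := by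
  have hR := H.isSelfAdjoint_modularSqrt
  let J := H.modularConj
  refine rank_complex_le_rank_real (fun y : H.defectSpace U (-1) => U y - J y)
    (fun y => ?_) (fun x y => ?_) (fun r y => ?_) fun y h₁ h₂ => ?_
  · have h₁ : U y - J y ∈ H.toClosedSubmodule := by
      have := mem_of_mem_graph_add y.2
      rwa [LinearMap.smul_apply, neg_one_smul, map_neg, ← sub_eq_add_neg] at this
    refine ⟨mem_symplComp_iff.2 fun k hk => ?_, h₁⟩
    have h₂ := LinearPMap.inner_eq_of_mem_graph hR (H.mem_iff_graph.1 h₁)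
      (H.mem_iff_graph.1 ((H.mem_image_iff U).1 hk))
    -- So x = Uy - Jy lies in H and in UJH. For k ∈ UH the number ⟪U^*k, Jx⟫ is real, since R is
    -- symmetric and acts as J on H; hence x ∈ (UH)'.
    have h₃ : U y - J y = U (-J (U y - J y)) := by
      rw [map_sub, H.modularConj_apply_symmetric hU, H.modularConj_modularConj, neg_sub, map_sub,
        U.apply_symm_apply]
    have h₄ : ⟪k, U y - J y⟫ = -⟪U.symm k, J (U y - J y)⟫ := by
      rw [← inner_neg_right, ← U.inner_map_map (U.symm k), U.apply_symm_apply, ← h₃]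
    rw [h₄, neg_im, neg_eq_zero, ← conj_eq_iff_im, inner_conj_symm, h₂, ← inner_conj_symm,
      inner_antiunitary_symm, H.modularConj_symm, inner_conj_symm]
  · simp only [Submodule.coe_add, map_add]
    abel
  · rw [Submodule.coe_smul, map_smul, modularConj_real_smul, ← smul_sub, Complex.coe_smul]
  · rw [Submodule.coe_smul, map_smul, map_smulₛₗ, conj_I, neg_smul, sub_neg_eq_add,
      ← smul_add] at h₂
    have h₃ := (smul_eq_zero.1 h₂).resolve_left I_ne_zero
    have h₄ : (2 : ℂ) • U y = 0 := by
      have : (2 : ℂ) • U y = (U y - J y) + (U y + J y) := by rw [two_smul]; abel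
      rw [this, h₁, h₃, add_zero]
    exact Subtype.ext (U.map_eq_zero_iff.1 ((smul_eq_zero.1 h₄).resolve_left two_ne_zero))

end Symmetric

end StandardSubspace

theorem mainTheorem3 {𝓗 : Type*} [NormedAddCommGroup 𝓗] [InnerProductSpace ℂ 𝓗] [CompleteSpace 𝓗]
    [TopologicalSpace.SeparableSpace 𝓗] (H : StandardSubspace 𝓗) (U : 𝓗 ≃ₗᵢ[ℂ] 𝓗)
    (hU : H.IsProperEndomorphism U) :
    (U = H.sharp U →
      H.deficiencyPos U + H.deficiencyNeg U ≤
          Module.rank ℝ ((H.image U)ᗮ ⊓ H.toClosedSubmodule).toSubmodule ∧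
        0 < H.deficiencyPos U + H.deficiencyNeg U) ∧
    (∀ V : 𝓗 ≃ₗᵢ[ℂ] 𝓗, H.IsEndomorphism V → V = H.sharp V → U = V ^ 2 →
      H.deficiencyPos U = H.deficiencyNeg U ∧
        H.deficiencyPos U ≤
          Module.rank ℝ ((H.image U).symplComp ⊓ H.toClosedSubmodule).toSubmodule ∧
        0 < H.deficiencyPos U ∧
        (H.image U).symplComp ⊓ H.toClosedSubmodule ≠ ⊥) := by
  simp only [StandardSubspace.deficiencyPos, StandardSubspace.deficiencyNeg,
    StandardSubspace.rank_pmapEigenspace_adjoint_opB]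
  refine ⟨fun hs => ⟨StandardSubspace.IsEndomorphism.rank_defectSpace_add_le hU.le hs,
    hU.rank_defectSpace_pos hs⟩, ?_⟩
  rintro V hE hV rfl
  have h₁ := hE.rank_defectSpace_sq hV (Or.inl rfl)
  have h₂ := hE.rank_defectSpace_sq hV (Or.inr (Or.inl rfl))
  have h₃ := hE.rank_defectSpace_sq hV (Or.inr (Or.inr rfl))
  have hpos := hE.rank_defectSpace_sq_pos hV hU
  have hle := StandardSubspace.rank_defectSpace_neg_one_le (StandardSubspace.sharp_sq hV)
  -- The bound was obtained at eigenvalue -1 and is transported to i through the common quotient.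
  rw [h₃, ← h₁] at hle
  refine ⟨h₁.trans h₂.symm, hle, hpos, fun h => ?_⟩
  rw [h] at hle
  exact (hpos.trans_le hle).ne' (rank_bot ℝ 𝓗)
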